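/- Let $N_a\ge 2$ agents sit at the vertices $V=\{1,\dots,N_a\}$ of an undirected, connected, $K$-regular graph without self-loops, with adjacency matrix $\bar A=(\bar a_{ik})$. Let $\lambda_{\max}$, $\lambda_{\min}$ be the greatest and smallest eigenvalues of $\bar A$, and let $W(\lambda)$ denote the generalized eigenspace of $\bar A$ for $\lambda$. Let $S:\mathbb R\to\mathbb R$ be a bounded odd $C^2$ function with $S(0)=0$, $S'(0)=1$ and $\operatorname{sign}S''(z)=-\operatorname{sign}z$ for all $z$. Let $d>0$, $\alpha>0$, $\gamma\in\mathbb R$, and consider the opinion dynamics with attention parameter $u$ $$\dot x_i=-d\,x_i+u\,S\Big(\alpha x_i+\gamma\sum_{k\ne i}\bar a_{ik}x_k\Big),\qquad i\in V .$$ Write $\|x\|=\max_i|x_i|$. Say that a steady-state bifurcation off $x=0$ occurs at $u_0$ along a subspace $W$ if $x=0$ is an equilibrium for all $u$; there are nonzero equilibria $x(u)$ for all $u>u_0$ close to $u_0$, with $x(u)\to0$ as $u\searrow u_0$; and, for every $\varepsilon>0$, every nonzero equilibrium $x$ at parameter $u$ with $(u,x)$ sufficiently close to $(u_0,0)$ lies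 within distance $\varepsilon\|x\|$ of $W$. Then $W(\lambda_{\max})=\operatorname{span}\{\mathbf 1\}$ and $W(\lambda_{\min})\subseteq\{x:\sum_i x_i=0\}$. Moreover: (A) If $\gamma>0$, then $\alpha+\gamma\lambda_{\max}>0$ and a steady-state bifurcation off $x=0$ occurs at $u_a=d/(\alpha+\gamma\lambda_{\max})$ along $W(\lambda_{\max})$. All nonzero equilibria with $(u,x)$ in some neighbourhood of $(u_a,0)$ are consensus solutions: all $x_i$ are nonzero and of the same sign, and $|x_i-x_k|<\vartheta$ for all $i,k\in V$ and every threshold $\vartheta>0$. In particular, for every $0<\vartheta<\|x\|$ such an $x$ is a consensus state in which all agents are opinionated ($|x_i|>\vartheta$). (B) If $\gamma<0$, then $\alpha+\gamma\lambda_{\min}>0$ and a steady-state bifurcation off $x=0$ occurs at $u_d=d/(\alpha+\gamma\lambda_{\min})$ along $W(\lambda_{\min})$. For every threshold $\vartheta>0$, all nonzero equilibria with $(u,x)$ sufficiently close to $(u_d,0)$ are dissensus solutions: $x_i>0>x_k$ for some $i,k\in V$, and $\big|\sum_{i}x_i\big|<\vartheta N_a$. This also holds relative to the size of the opinions: for every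 $\varepsilon>0$, all nonzero equilibria with $(u,x)$ sufficiently close to $(u_d,0)$ are dissensus solutions for every threshold $\vartheta\ge\varepsilon\|x\|$, and if moreover $\vartheta N_a\le\|x\|$ then some agents $i,k$ are opinionated in favour of opposite options, $x_i>\vartheta$ and $x_k<-\vartheta$. -/

import Mathlib

open Filter Topology

/-- The nonlinearity `S`: an odd, saturating (bounded) function of class `C²` with `S 0 = 0`,
`S' 0 = 1` and `sign (S'' z) = - sign z`. -/
structure IsOddSaturating (S : ℝ → ℝ) : Prop where
  contDiff : ContDiff ℝ 2 S
  odd : ∀ z, S (-z) = -S z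
  map_zero : S 0 = 0
  deriv_zero : deriv S 0 = 1
  sign_deriv2 : ∀ z, SignType.sign (deriv (deriv S) z) = -SignType.sign z
  saturating : ∃ M, ∀ z, |S z| ≤ M

section Model

variable {V : Type*} [Fintype V] [DecidableEq V]

/-- Right-hand side `h` of the homogeneous opinion dynamics
`ẋᵢ = - d xᵢ + uᵢ S (α xᵢ + γ ∑_{k ≠ i} aᵢₖ xₖ) + bᵢ`. -/
def opinionField (S : ℝ → ℝ) (d α γ : ℝ) (A : Matrix V V ℝ) (u b : V → ℝ)
    (x : V → ℝ) : V → ℝ :=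
  fun i => -d * x i + u i * S (α * x i + γ * ∑ k ∈ Finset.univ.erase i, A i k * x k) + b i

/-- The one-parameter family of vector fields with static equal attention `uᵢ = u` and
zero inputs `bᵢ = 0`, on an undirected graph `G`. -/
def unbiasedField (S : ℝ → ℝ) (d α γ : ℝ) (G : SimpleGraph V) [DecidableRel G.Adj]
    (u : ℝ) (x : V → ℝ) : V → ℝ :=
  opinionField S d α γ (G.adjMatrix ℝ) (fun _ => u) (fun _ => 0) x

/-- `x` is a nonzero equilibrium of the vector field `f`. -/
def IsNontrivialEquilibrium (f : (V → ℝ) → (V → ℝ)) (x : V → ℝ) : Prop :=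
  x ≠ 0 ∧ f x = 0

/-- The greatest eigenvalue of the adjacency matrix (all eigenvalues are real, the matrix being
symmetric). -/
noncomputable def lamMax (G : SimpleGraph V) [DecidableRel G.Adj] : ℝ :=
  sSup (spectrum ℝ (G.adjMatrix ℝ))

/-- The smallest eigenvalue of the adjacency matrix. -/
noncomputable def lamMin (G : SimpleGraph V) [DecidableRel G.Adj] : ℝ :=
  sInf (spectrum ℝ (G.adjMatrix ℝ))

/-- The supremum and infimum above are attained. -/
theorem lamMax_lamMin_spec [Nonempty V] (G : SimpleGraph V) [DecidableRel G.Adj] :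
    IsGreatest (spectrum ℝ (G.adjMatrix ℝ)) (lamMax G) ∧
      IsLeast (spectrum ℝ (G.adjMatrix ℝ)) (lamMin G) := by
  have hA : (G.adjMatrix ℝ).IsHermitian := by
    rw [Matrix.IsHermitian, Matrix.conjTranspose_eq_transpose_of_trivial]
    exact G.isSymm_adjMatrix
  have hs := hA.spectrum_real_eq_range_eigenvalues
  have hf : (spectrum ℝ (G.adjMatrix ℝ)).Finite := hs ▸ Set.finite_range _
  have hn : (spectrum ℝ (G.adjMatrix ℝ)).Nonempty := hs ▸ Set.range_nonempty _
  exact ⟨⟨hn.csSup_mem hf, fun _ h => le_csSup hf.bddAbove h⟩,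
    ⟨hn.csInf_mem hf, fun _ h => csInf_le hf.bddBelow h⟩⟩

/-- `W(lam)`: the generalized eigenspace of the adjacency matrix for `lam`. -/
noncomputable def genEigenspace (G : SimpleGraph V) [DecidableRel G.Adj] (lam : ℝ) :
    Submodule ℝ (V → ℝ) :=
  Module.End.maxGenEigenspace (Matrix.toLin' (G.adjMatrix ℝ)) lam

end Model

section States

variable {V : Type*} [Fintype V]

/-- The consensus space, spanned by the all-ones vector. -/
def consensusSpace (V : Type*) : Submodule ℝ (V → ℝ) :=
  Submodule.span ℝ {fun _ => 1}

/-- The dissensus space of vectors whose entries sum to zero. -/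
def dissensusSpace (V : Type*) [Fintype V] : Submodule ℝ (V → ℝ) where
  carrier := {x | ∑ i, x i = 0}
  add_mem' := by
    intro x y hx hy
    simp only [Set.mem_ofPred_eq] at hx hy ⊢
    simp [Finset.sum_add_distrib, hx, hy]
  zero_mem' := by simp
  smul_mem' := by
    intro c x hx
    simp only [Set.mem_ofPred_eq] at hx ⊢
    simp [← Finset.mul_sum, hx]

/-- All opinions are nonzero and have the same sign. -/
def SameSign (x : V → ℝ) : Prop :=
  (∀ i, x i ≠ 0) ∧ ∀ i k, SignType.sign (x i) = SignType.sign (x k)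

/-- Agreement state: all agents are opinionated (`|xᵢ| > θ`) and favor the same option. -/
def IsAgreementState (θ : ℝ) (x : V → ℝ) : Prop :=
  (∀ i, θ < |x i|) ∧ SameSign x

/-- Consensus state: an agreement state in which opinions are `θ`-close to each other. -/
def IsConsensusState (θ : ℝ) (x : V → ℝ) : Prop :=
  IsAgreementState θ x ∧ ∀ i k, |x i - x k| < θ

/-- Disagreement state: some two agents favor different options. -/
def IsDisagreementState (x : V → ℝ) : Prop :=
  ∃ i k, 0 < x i ∧ x k < 0

/-- Dissensus state: a disagreement state that is unopinionated on average. -/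
def IsDissensusState (θ : ℝ) (x : V → ℝ) : Prop :=
  IsDisagreementState x ∧ |∑ i, x i| < θ * Fintype.card V

/-- The family of vector fields `F u` has a steady-state bifurcation off the equilibrium `0` at
the parameter value `u₀`, along the subspace `W`: nonzero equilibria exist for every `u` slightly
above `u₀` and shrink to `0` as `u` decreases to `u₀`; and all nonzero equilibria near `(u₀, 0)`
are asymptotically tangent to `W`. -/
def HasBifurcationAlong (F : ℝ → (V → ℝ) → (V → ℝ)) (u₀ : ℝ)
    (W : Submodule ℝ (V → ℝ)) : Prop :=
  (∀ u, F u 0 = 0) ∧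
  (∃ x : ℝ → V → ℝ, Tendsto x (𝓝[>] u₀) (𝓝 0) ∧
    ∀ᶠ u in 𝓝[>] u₀, IsNontrivialEquilibrium (F u) (x u)) ∧
  ∀ ε > 0, ∀ᶠ p : ℝ × (V → ℝ) in 𝓝 (u₀, 0), IsNontrivialEquilibrium (F p.1) p.2 →
    ∃ w ∈ W, ‖p.2 - w‖ ≤ ε * ‖p.2‖

end States

/-! With `B = α + γA` and `μ = α + γλ`, equilibria solve `d x = u S(Bx)`. Here `λ` is the extreme
eigenvalue of `A` that makes `μ` the largest eigenvalue of `B`: `lamMax` for `γ > 0`, `lamMin` for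
`γ < 0`.

Existence is variational, so `μ` need not be simple. Put `y = Bx`, `κ = u/d`; the equation becomes
`y = κ B S(y)`, the critical point equation of `equilibriumEnergy` wherever `S' > 0`. For `κμ`
slightly above 1 this energy is negative at small multiples of a `μ`-eigenvector and positive on a
fixed small sphere, because `∫ s S'` strictly exceeds `S²/2`. A minimiser over the ball is thus
interior and nonzero (`exists_fixedPoint`).

Tangency is linear algebra: near the critical point `(μ - B)x = o(‖x‖)`, and the distance to a
kernel is controlled by the size of the image.

For `γ > 0` the kernel is spanned by the constants, and a contraction estimate on `x` minus its mean
forces that difference to vanish, so consensus is exact. For `γ < 0` the kernel lies in the zero-sum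
space, so the entries nearly cancel and both signs occur with size at least of order `‖x‖/n`. -/

/-! ### Elementary estimates for `S`. -/

namespace IsOddSaturating

variable {S : ℝ → ℝ}

theorem differentiable (hS : IsOddSaturating S) : Differentiable ℝ S :=
  hS.contDiff.differentiable (by norm_num)

theorem continuous_deriv (hS : IsOddSaturating S) : Continuous (deriv S) :=
  hS.contDiff.continuous_deriv (by norm_num)

theorem deriv_neg_arg (hS : IsOddSaturating S) (x : ℝ) : deriv S (-x) = deriv S x := by
  have h := deriv_comp_neg S x
  have h' : (fun x => S (-x)) = fun x => -S x := funext hS.odd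
  rw [h', deriv.fun_neg] at h
  linarith

/-- The sign of `S''` makes `S'` strictly decreasing on `[0, ∞)`, starting from `S' 0 = 1`. -/
theorem deriv_lt_one (hS : IsOddSaturating S) {x : ℝ} (hx : 0 < x) : deriv S x < 1 := by
  have h : StrictAntiOn (deriv S) (Set.Ici 0) := by
    refine strictAntiOn_of_deriv_neg (convex_Ici 0) hS.continuous_deriv.continuousOn ?_
    intro z hz
    rw [interior_Ici, Set.mem_Ioi] at hz
    have h := hS.sign_deriv2 z
    rw [sign_pos hz] at h
    exact sign_eq_neg_one_iff.1 h
  have := h (Set.mem_Ici.2 le_rfl) (Set.mem_Ici.2 hx.le) hx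
  rwa [hS.deriv_zero] at this

theorem lt_self (hS : IsOddSaturating S) {x : ℝ} (hx : 0 < x) : S x < x := by
  have h : StrictMonoOn (fun y => y - S y) (Set.Ici 0) := by
    refine strictMonoOn_of_deriv_pos (convex_Ici 0)
      (continuous_id.sub hS.differentiable.continuous).continuousOn ?_
    intro z hz
    rw [interior_Ici, Set.mem_Ioi] at hz
    have := ((hasDerivAt_id z).sub (hS.differentiable z).hasDerivAt).deriv
    have h2 := hS.deriv_lt_one hz
    change 0 < deriv (id - S) z
    rw [this]
    linarith
  have := h (Set.mem_Ici.2 le_rfl) (Set.mem_Ici.2 hx.le) hx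
  simp only [hS.map_zero] at this
  linarith

/-- Near `0`, the nonlinearity differs from the identity by a map with small Lipschitz constant. -/
theorem exists_abs_sub_sub_le (hS : IsOddSaturating S) {δ : ℝ} (hδ : 0 < δ) :
    ∃ ρ > 0, ∀ a b, |a| < ρ → |b| < ρ → |S a - S b - (a - b)| ≤ δ * |a - b| := by
  have h : HasStrictDerivAt S 1 0 := by
    have := (hS.contDiff.contDiffAt (x := (0 : ℝ))).hasStrictDerivAt (by norm_num)
    rwa [hS.deriv_zero] at this
  have h2 := h.isLittleO.def hδ
  obtain ⟨ρ, hρ, hb⟩ := Metric.eventually_nhds_iff.1 h2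
  refine ⟨ρ, hρ, fun a b ha hb' => ?_⟩
  have := @hb (a, b) (by simpa [Prod.dist_eq] using ⟨ha, hb'⟩)
  simpa using this

end IsOddSaturating

/-! ### The Legendre primitive, squeezed between `S²/2` and `y²/2`. -/

/-- The primitive `∫₀ʸ s S'(s) ds`, the Legendre transform of `∫ S` at `S y`. -/
noncomputable def legendrePrimitive (S : ℝ → ℝ) (y : ℝ) : ℝ :=
  ∫ s in (0 : ℝ)..y, s * deriv S s

namespace IsOddSaturating

variable {S : ℝ → ℝ}

theorem hasDerivAt_legendrePrimitive (hS : IsOddSaturating S) (y : ℝ) :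
    HasDerivAt (legendrePrimitive S) (y * deriv S y) y := by
  have hc : Continuous fun s => s * deriv S s := continuous_id.mul hS.continuous_deriv
  exact intervalIntegral.integral_hasDerivAt_right (hc.intervalIntegrable _ _)
    (hc.stronglyMeasurableAtFilter _ _) hc.continuousAt

theorem legendrePrimitive_neg (hS : IsOddSaturating S) (y : ℝ) :
    legendrePrimitive S (-y) = legendrePrimitive S y := by
  have h := intervalIntegral.integral_comp_neg (a := 0) (b := y) (fun s => s * deriv S s)
  simp only [hS.deriv_neg_arg, neg_mul, intervalIntegral.integral_neg, neg_zero] at h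
  rw [legendrePrimitive, legendrePrimitive, intervalIntegral.integral_symm, ← h, neg_neg]

theorem legendrePrimitive_abs (hS : IsOddSaturating S) (y : ℝ) :
    legendrePrimitive S |y| = legendrePrimitive S y := by
  rcases abs_choice y with h | h <;> rw [h]
  exact hS.legendrePrimitive_neg y

theorem sq_map_abs (hS : IsOddSaturating S) (y : ℝ) : S |y| ^ 2 = S y ^ 2 := by
  rcases abs_choice y with h | h <;> rw [h]
  rw [hS.odd, neg_sq]

theorem legendrePrimitive_zero : legendrePrimitive S 0 = 0 := by
  simp [legendrePrimitive]

theorem legendrePrimitive_le (hS : IsOddSaturating S) (y : ℝ) :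
    legendrePrimitive S y ≤ y ^ 2 / 2 := by
  have hd : ∀ z, HasDerivAt (fun z => z ^ 2 / 2 - legendrePrimitive S z)
      (z - z * deriv S z) z := fun z => by
    have := (((hasDerivAt_id z).pow 2).div_const 2).sub (hS.hasDerivAt_legendrePrimitive z)
    exact this.congr_deriv (by simp)
  have h : MonotoneOn (fun z => z ^ 2 / 2 - legendrePrimitive S z) (Set.Ici 0) := by
    refine monotoneOn_of_deriv_nonneg (convex_Ici 0)
      (fun z _ => (hd z).continuousAt.continuousWithinAt)
      (fun z _ => (hd z).differentiableAt.differentiableWithinAt) ?_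
    intro z hz
    rw [interior_Ici, Set.mem_Ioi] at hz
    rw [(hd z).deriv]
    nlinarith [hS.deriv_lt_one hz]
  have := h (Set.mem_Ici.2 le_rfl) (Set.mem_Ici.2 (abs_nonneg y)) (abs_nonneg y)
  simp only [legendrePrimitive_zero, hS.legendrePrimitive_abs, sq_abs] at this
  linarith

/-- The difference has derivative `S'(z)(z - S z)`, positive for small `z > 0`; evenness covers
negative `y`. This strict surplus is what confines the minimiser to the interior of the ball. -/
theorem sq_div_two_lt_legendrePrimitive (hS : IsOddSaturating S) {ε : ℝ}
    (hε : ∀ z, |z| ≤ ε → 0 < deriv S z) {y : ℝ} (hy : y ≠ 0) (hyε : |y| ≤ ε) :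
    S y ^ 2 / 2 < legendrePrimitive S y := by
  have hd : ∀ z, HasDerivAt (fun z => legendrePrimitive S z - S z ^ 2 / 2)
      (deriv S z * (z - S z)) z := fun z => by
    have := (hS.hasDerivAt_legendrePrimitive z).sub
      (((hS.differentiable z).hasDerivAt.pow 2).div_const 2)
    exact this.congr_deriv (by simp; ring)
  have h : StrictMonoOn (fun z => legendrePrimitive S z - S z ^ 2 / 2) (Set.Icc 0 ε) := by
    refine strictMonoOn_of_deriv_pos (convex_Icc 0 ε)
      (fun z _ => (hd z).continuousAt.continuousWithinAt) ?_
    intro z hz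
    rw [interior_Icc, Set.mem_Ioo] at hz
    rw [(hd z).deriv]
    have := hS.lt_self hz.1
    exact mul_pos (hε z (by rw [abs_of_pos hz.1]; exact hz.2.le)) (by linarith)
  have hε0 : 0 ≤ ε := (abs_nonneg y).trans hyε
  have := h (Set.left_mem_Icc.2 hε0) ⟨abs_nonneg y, hyε⟩ (abs_pos.2 hy)
  simp only [legendrePrimitive_zero, hS.legendrePrimitive_abs, hS.sq_map_abs, hS.map_zero] at this
  linarith

theorem sq_map_le (hS : IsOddSaturating S) {ε : ℝ}
    (hε : ∀ z, |z| ≤ ε → 0 < deriv S z) {y : ℝ} (hyε : |y| ≤ ε) : S y ^ 2 ≤ y ^ 2 := by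
  rcases eq_or_ne y 0 with rfl | hy
  · simp [hS.map_zero]
  · linarith [hS.sq_div_two_lt_legendrePrimitive hε hy hyε, hS.legendrePrimitive_le y]

theorem exists_deriv_pos (hS : IsOddSaturating S) :
    ∃ ε > 0, ∀ z, |z| ≤ ε → 0 < deriv S z := by
  have h : ∀ᶠ z in 𝓝 (0 : ℝ), 0 < deriv S z :=
    hS.continuous_deriv.continuousAt.eventually (lt_mem_nhds (by rw [hS.deriv_zero]; norm_num))
  obtain ⟨ε, hε, hb⟩ := Metric.eventually_nhds_iff.1 h
  refine ⟨ε / 2, by positivity, fun z hz => hb ?_⟩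
  rw [Real.dist_eq, sub_zero]
  linarith

end IsOddSaturating

/-! ### Existence of small solutions by minimisation. -/

section Energy

variable {V : Type*} [Fintype V]

theorem hasDerivAt_quadraticForm {B : Matrix V V ℝ} (hB : B.IsSymm) {s : ℝ → V → ℝ} {s' : V → ℝ}
    {t : ℝ} (hs : ∀ i, HasDerivAt (fun t => s t i) (s' i) t) :
    HasDerivAt (fun t => s t ⬝ᵥ B.mulVec (s t)) (2 * (s' ⬝ᵥ B.mulVec (s t))) t := by
  have h : HasDerivAt (fun t => ∑ i, s t i * ∑ j, B i j * s t j)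
      (∑ i, (s' i * ∑ j, B i j * s t j + s t i * ∑ j, B i j * s' j)) t :=
    HasDerivAt.fun_sum fun i _ =>
      (hs i).mul (HasDerivAt.fun_sum fun j _ => (hs j).const_mul (B i j))
  refine h.congr_deriv ?_
  have hsymm : s t ⬝ᵥ B.mulVec s' = s' ⬝ᵥ B.mulVec (s t) := by
    rw [Matrix.dotProduct_mulVec, ← Matrix.mulVec_transpose, hB.eq, dotProduct_comm]
  rw [Finset.sum_add_distrib]
  change s' ⬝ᵥ B.mulVec (s t) + s t ⬝ᵥ B.mulVec s' = _
  rw [hsymm]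
  ring

/-- A function of `y` whose critical points near `0` solve `y = κ B S(y)`. -/
noncomputable def equilibriumEnergy (S : ℝ → ℝ) (B : Matrix V V ℝ) (κ : ℝ) (y : V → ℝ) : ℝ :=
  ∑ i, legendrePrimitive S (y i) - κ / 2 * ((S ∘ y) ⬝ᵥ B.mulVec (S ∘ y))

variable {S : ℝ → ℝ} {B : Matrix V V ℝ}

theorem IsOddSaturating.continuous_equilibriumEnergy (hS : IsOddSaturating S) (κ : ℝ) :
    Continuous (equilibriumEnergy S B κ) := by
  have h1 : Continuous S := hS.differentiable.continuous
  have h2 : Continuous (legendrePrimitive S) :=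
    continuous_iff_continuousAt.2 fun y => (hS.hasDerivAt_legendrePrimitive y).continuousAt
  unfold equilibriumEnergy dotProduct Matrix.mulVec dotProduct
  simp only [Function.comp_apply]
  fun_prop

/-- The `i`-th partial derivative of the energy is `S'(y i) (y i - κ (B S(y)) i)`, and the first
factor cancels. -/
theorem IsOddSaturating.eq_of_isLocalMin_equilibriumEnergy [DecidableEq V]
    (hS : IsOddSaturating S) (hB : B.IsSymm) {κ : ℝ} {y : V → ℝ}
    (hy : IsLocalMin (equilibriumEnergy S B κ) y) {i : V} (hi : 0 < deriv S (y i)) :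
    y i = κ * B.mulVec (S ∘ y) i := by
  have hu : ∀ j, HasDerivAt (fun t => Function.update y i t j) ((Pi.single i (1 : ℝ) : V → ℝ) j)
      (y i) := hasDerivAt_pi.1 (hasDerivAt_update y i (y i))
  have hself : Function.update y i (y i) = y := Function.update_eq_self i y
  have hG : HasDerivAt (fun t => ∑ j, legendrePrimitive S (Function.update y i t j))
      (∑ j, y j * deriv S (y j) * (Pi.single i (1 : ℝ) : V → ℝ) j) (y i) := by
    refine HasDerivAt.fun_sum fun j _ => ?_
    refine HasDerivAt.comp (h₂ := legendrePrimitive S) (y i) ?_ (hu j)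
    rw [hself]
    exact hS.hasDerivAt_legendrePrimitive (y j)
  have hq := hasDerivAt_quadraticForm hB (s := fun t => S ∘ Function.update y i t)
    (s' := fun j => deriv S (y j) * (Pi.single i (1 : ℝ) : V → ℝ) j) (t := y i) (by
      intro j
      refine HasDerivAt.comp (y i) ?_ (hu j)
      rw [hself]
      exact (hS.differentiable (y j)).hasDerivAt)
  have hd := hG.sub (hq.const_mul (κ / 2))
  have hmin : IsLocalMin (fun t => equilibriumEnergy S B κ (Function.update y i t)) (y i) := by
    have hc : ContinuousAt (fun t => Function.update y i t) (y i) :=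
      (hasDerivAt_update y i (y i)).continuousAt
    have := hc.eventually (p := fun z => equilibriumEnergy S B κ y ≤ equilibriumEnergy S B κ z)
      (by beta_reduce; rw [hself]; exact hy)
    filter_upwards [this] with t ht
    rwa [hself]
  have h0 := hmin.hasDerivAt_eq_zero hd
  simp only [hself, dotProduct, Pi.single_apply, mul_ite, mul_one, mul_zero, ite_mul, zero_mul,
    Finset.sum_ite_eq', Finset.mem_univ, if_true] at h0
  have : deriv S (y i) * (y i - κ * B.mulVec (S ∘ y) i) = 0 := by linarith
  rcases mul_eq_zero.1 this with h | h
  · exact absurd h hi.ne'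
  · linarith

/-- A coordinate with `|y i| = ε` contributes the whole surplus `legendrePrimitive S ε - S ε ^ 2 /
2`, the others at least 0. The quadratic term exceeds `∑ S(y j)²/2` by at most `(κμ - 1)/2 · nε²`,
which `hlt` keeps below that surplus. -/
theorem IsOddSaturating.equilibriumEnergy_pos (hS : IsOddSaturating S) {κ μ ε : ℝ}
    (hBμ : ∀ x, x ⬝ᵥ B.mulVec x ≤ μ * (x ⬝ᵥ x)) (hκ : 0 ≤ κ) (hκμ : 1 ≤ κ * μ)
    (hε : ∀ z, |z| ≤ ε → 0 < deriv S z) (hε0 : 0 < ε)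
    (hlt : (κ * μ - 1) / 2 * (Fintype.card V * ε ^ 2) < legendrePrimitive S ε - S ε ^ 2 / 2)
    {y : V → ℝ} (hy : ‖y‖ = ε) : 0 < equilibriumEnergy S B κ y := by
  have hle : ∀ i, |y i| ≤ ε := fun i => by
    rw [← hy, ← Real.norm_eq_abs]
    exact norm_le_pi_norm y i
  obtain ⟨i, hi⟩ : ∃ i, |y i| = ε := by
    have hne : Nonempty V := by
      by_contra h
      rw [not_nonempty_iff] at h
      rw [Subsingleton.elim y 0, norm_zero] at hy
      exact hε0.ne hy
    obtain ⟨i, -, hi⟩ := Finset.exists_max_image Finset.univ (fun i => |y i|)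
      Finset.univ_nonempty
    refine ⟨i, le_antisymm (hle i) ?_⟩
    rw [← hy]
    exact (pi_norm_le_iff_of_nonneg (abs_nonneg _)).2 fun j => hi j (Finset.mem_univ j)
  have hnn : ∀ j, 0 ≤ legendrePrimitive S (y j) - S (y j) ^ 2 / 2 := fun j => by
    rcases eq_or_ne (y j) 0 with h | h
    · simp [h, legendrePrimitive_zero, hS.map_zero]
    · linarith [hS.sq_div_two_lt_legendrePrimitive hε h (hle j)]
  have h1 : legendrePrimitive S ε - S ε ^ 2 / 2 ≤
      ∑ j, (legendrePrimitive S (y j) - S (y j) ^ 2 / 2) := by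
    refine le_trans (le_of_eq ?_)
      (Finset.single_le_sum (fun j _ => hnn j) (Finset.mem_univ i))
    rw [← hi, hS.legendrePrimitive_abs, hS.sq_map_abs]
  have h2 : (S ∘ y) ⬝ᵥ (S ∘ y) ≤ Fintype.card V * ε ^ 2 := by
    have : ∀ j ∈ Finset.univ, S (y j) * S (y j) ≤ ε ^ 2 := fun j _ => by
      have := hS.sq_map_le hε (hle j)
      have h3 := sq_le_sq' (by linarith [hle j, abs_nonneg (y j)]) (hle j)
      rw [sq_abs] at h3
      nlinarith
    have := Finset.sum_le_card_nsmul _ _ _ this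
    simpa [dotProduct] using this
  have h3 : κ * ((S ∘ y) ⬝ᵥ B.mulVec (S ∘ y)) ≤ κ * μ * ((S ∘ y) ⬝ᵥ (S ∘ y)) := by
    rw [mul_assoc]
    exact mul_le_mul_of_nonneg_left (hBμ _) hκ
  have h4 := mul_le_mul_of_nonneg_left h2 (show 0 ≤ (κ * μ - 1) / 2 by linarith)
  have h5 : ∑ j, (legendrePrimitive S (y j) - S (y j) ^ 2 / 2) =
      ∑ j, legendrePrimitive S (y j) - ((S ∘ y) ⬝ᵥ (S ∘ y)) / 2 := by
    rw [Finset.sum_sub_distrib, ← Finset.sum_div]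
    simp [dotProduct, sq]
  unfold equilibriumEnergy
  linarith

/-- To leading order the energy at `t • v` is `t²/2 · (1 - κμ) (v ⬝ᵥ v)`, since `S(t v i)/t → v i`;
the primitive only needs its upper bound `y²/2`. -/
theorem IsOddSaturating.eventually_equilibriumEnergy_neg (hS : IsOddSaturating S) {κ μ : ℝ}
    (hκ : 0 < κ) (hκμ : 1 < κ * μ) {v : V → ℝ} (hv : v ≠ 0) (hBv : B.mulVec v = μ • v) :
    ∀ᶠ t : ℝ in 𝓝[≠] 0, equilibriumEnergy S B κ (t • v) < 0 := by
  have hvv : 0 < v ⬝ᵥ v := by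
    have := Matrix.dotProduct_star_self_pos_iff.2 hv
    simpa using this
  have hlim : ∀ i, Tendsto (fun t : ℝ => t⁻¹ * S (t * v i)) (𝓝[≠] 0) (𝓝 (v i)) := fun i => by
    have h : HasDerivAt (fun t : ℝ => S (t * v i)) (v i) 0 := by
      have h1 : HasDerivAt S 1 (0 * v i) := by
        rw [zero_mul, ← hS.deriv_zero]
        exact (hS.differentiable 0).hasDerivAt
      exact (h1.comp 0 ((hasDerivAt_id (0 : ℝ)).mul_const (v i))).congr_deriv (by simp)
    have := h.tendsto_slope_zero
    simpa [hS.map_zero] using this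
  have hq : Tendsto (fun t : ℝ => κ * ((fun i => t⁻¹ * S (t * v i)) ⬝ᵥ
      B.mulVec fun i => t⁻¹ * S (t * v i))) (𝓝[≠] 0) (𝓝 (κ * (v ⬝ᵥ B.mulVec v))) :=
    (tendsto_finsetSum _ fun i _ => (hlim i).mul
      (tendsto_finsetSum _ fun j _ => (hlim j).const_mul (B i j))).const_mul κ
  have hlt : v ⬝ᵥ v < κ * (v ⬝ᵥ B.mulVec v) := by
    rw [hBv, dotProduct_smul, smul_eq_mul, ← mul_assoc]
    nlinarith
  filter_upwards [hq.eventually (lt_mem_nhds hlt), self_mem_nhdsWithin] with t ht ht0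
  have ht0 : t ≠ 0 := ht0
  have hs : (fun i => t⁻¹ * S (t * v i)) = t⁻¹ • (S ∘ (t • v)) := by
    ext i
    simp
  rw [hs, Matrix.mulVec_smul, dotProduct_smul, smul_dotProduct, smul_eq_mul, smul_eq_mul] at ht
  have h1 : ∑ i, legendrePrimitive S ((t • v) i) ≤ t ^ 2 / 2 * (v ⬝ᵥ v) := by
    rw [dotProduct, Finset.mul_sum]
    refine Finset.sum_le_sum fun i _ => (hS.legendrePrimitive_le _).trans (le_of_eq ?_)
    simp only [Pi.smul_apply, smul_eq_mul]
    ring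
  have ht2 : 0 < t ^ 2 := by positivity
  have h2 := mul_lt_mul_of_pos_left ht ht2
  have h3 : t ^ 2 * (κ * (t⁻¹ * (t⁻¹ * ((S ∘ (t • v)) ⬝ᵥ B.mulVec (S ∘ (t • v)))))) =
      κ * ((S ∘ (t • v)) ⬝ᵥ B.mulVec (S ∘ (t • v))) := by
    field_simp
  rw [h3] at h2
  unfold equilibriumEnergy
  linarith

/-- Nonzero solutions of `y = κ B S(y)` of arbitrarily small norm, for `κ μ` slightly above `1`. -/
theorem IsOddSaturating.exists_fixedPoint [DecidableEq V] (hS : IsOddSaturating S) (hB : B.IsSymm)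
    {μ : ℝ} (hμ : 0 < μ) (hBμ : ∀ x, x ⬝ᵥ B.mulVec x ≤ μ * (x ⬝ᵥ x)) {v : V → ℝ} (hv : v ≠ 0)
    (hBv : B.mulVec v = μ • v) {ε₀ : ℝ} (hε₀ : 0 < ε₀) :
    ∃ η > 0, ∀ κ, 1 < κ * μ → κ * μ < 1 + η →
      ∃ y : V → ℝ, y ≠ 0 ∧ ‖y‖ ≤ ε₀ ∧ y = κ • B.mulVec (S ∘ y) ∧
        ∀ i, |S (y i)| ≤ |y i| := by
  obtain ⟨ε₁, hε₁, hd₁⟩ := hS.exists_deriv_pos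
  set ε := min ε₀ ε₁ with hεdef
  have hε : 0 < ε := lt_min hε₀ hε₁
  have hd : ∀ z, |z| ≤ ε → 0 < deriv S z := fun z hz => hd₁ z (hz.trans (min_le_right _ _))
  have hm : 0 < legendrePrimitive S ε - S ε ^ 2 / 2 := by
    linarith [hS.sq_div_two_lt_legendrePrimitive hd hε.ne' (abs_of_pos hε).le]
  have hne : Nonempty V := by
    by_contra h
    rw [not_nonempty_iff] at h
    exact hv (Subsingleton.elim _ _)
  have hn : 0 < (Fintype.card V : ℝ) * ε ^ 2 := by positivity
  -- This `η` is the surplus divided by `nε²`, as the positivity on the sphere requires (with a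
  -- factor 2 to spare).
  refine ⟨(legendrePrimitive S ε - S ε ^ 2 / 2) / (Fintype.card V * ε ^ 2), by positivity,
    fun κ h1 h2 => ?_⟩
  have hκ : 0 < κ := pos_of_mul_pos_left (by linarith) hμ.le
  have h2' : (κ * μ - 1) * (Fintype.card V * ε ^ 2) < legendrePrimitive S ε - S ε ^ 2 / 2 := by
    rw [← lt_div_iff₀ hn]
    linarith
  obtain ⟨y, hyb, hy⟩ := (isCompact_closedBall (0 : V → ℝ) ε).exists_isMinOn
    ⟨0, Metric.mem_closedBall_self hε.le⟩
    (hS.continuous_equilibriumEnergy (B := B) κ).continuousOn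
  rw [mem_closedBall_zero_iff] at hyb
  have hneg : equilibriumEnergy S B κ y < 0 := by
    have hsmall : ∀ᶠ t : ℝ in 𝓝[≠] 0, ‖t • v‖ < ε := by
      have hc : Continuous fun t : ℝ => ‖t • v‖ := by fun_prop
      exact (hc.tendsto 0).eventually (gt_mem_nhds (by simpa using hε))
        |>.filter_mono nhdsWithin_le_nhds
    obtain ⟨t, ht, htε⟩ :=
      ((hS.eventually_equilibriumEnergy_neg hκ h1 hv hBv).and hsmall).exists
    exact (hy (mem_closedBall_zero_iff.2 htε.le)).trans_lt ht
  have hy0 : y ≠ 0 := by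
    rintro rfl
    have hz : S ∘ (0 : V → ℝ) = 0 := by
      ext i
      simp [hS.map_zero]
    simp [equilibriumEnergy, legendrePrimitive_zero, hz] at hneg
  have hyε : ‖y‖ < ε := by
    refine lt_of_le_of_ne hyb fun h => ?_
    refine (hS.equilibriumEnergy_pos (B := B) hBμ hκ.le h1.le hd hε ?_ h).not_gt hneg
    nlinarith
  have hloc : IsLocalMin (equilibriumEnergy S B κ) y :=
    hy.isLocalMin (Metric.closedBall_mem_nhds_of_mem (mem_ball_zero_iff.2 hyε))
  have hyi : ∀ i, |y i| ≤ ε := fun i => by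
    rw [← Real.norm_eq_abs]
    exact (norm_le_pi_norm y i).trans hyb
  refine ⟨y, hy0, hyb.trans (min_le_left _ _), ?_, fun i => sq_le_sq.1 (hS.sq_map_le hd (hyi i))⟩
  ext i
  exact hS.eq_of_isLocalMin_equilibriumEnergy hB hloc (hd _ (hyi i))

end Energy

/-! ### Equilibria near the critical parameter: tangency and selection of a branch. -/

theorem eventually_abs_sub_div_le {E : Type*} [TopologicalSpace E] (e : E) {d μ : ℝ}
    (hd : 0 < d) (hμ : 0 < μ) {δ : ℝ} (hδ : 0 < δ) :
    ∀ᶠ p : ℝ × E in 𝓝 (d / μ, e), 0 < p.1 ∧ |μ - d / p.1| ≤ δ := by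
  have h0 : d / μ ≠ 0 := by positivity
  have h1 : ∀ᶠ u in 𝓝 (d / μ), 0 < u := lt_mem_nhds (by positivity)
  have h2 : Tendsto (fun u => |μ - d / u|) (𝓝 (d / μ)) (𝓝 |μ - d / (d / μ)|) :=
    (tendsto_const_nhds.sub (tendsto_const_nhds.div tendsto_id h0)).abs
  have h3 : |μ - d / (d / μ)| = 0 := by
    rw [div_div_cancel₀ hd.ne', sub_self, abs_zero]
  rw [h3] at h2
  have h4 := h1.and (h2.eventually (gt_mem_nhds hδ))
  exact (continuous_fst.tendsto _).eventually h4 |>.mono fun p hp => ⟨hp.1, hp.2.le⟩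

section Bifurcation

variable {V : Type*} [Fintype V]

/-- A linear right inverse `g` of `T` on its finite-dimensional range is bounded, and `x - g (T x)`
lies in the kernel. -/
theorem LinearMap.exists_mem_ker_norm_sub_le {E F : Type*} [NormedAddCommGroup E]
    [NormedSpace ℝ E] [NormedAddCommGroup F] [NormedSpace ℝ F] [FiniteDimensional ℝ F]
    (T : E →ₗ[ℝ] F) : ∃ C > 0, ∀ x, ∃ w ∈ LinearMap.ker T, ‖x - w‖ ≤ C * ‖T x‖ := by
  obtain ⟨g, hg⟩ := T.rangeRestrict.exists_rightInverse_of_surjective T.range_rangeRestrict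
  let g' := LinearMap.toContinuousLinearMap g
  refine ⟨‖g'‖ + 1, by positivity, fun x => ⟨x - g (T.rangeRestrict x), ?_, ?_⟩⟩
  · have h : T.rangeRestrict (g (T.rangeRestrict x)) = T.rangeRestrict x :=
      LinearMap.congr_fun hg _
    have h' := congrArg Subtype.val h
    simp only [LinearMap.codRestrict_apply, LinearMap.rangeRestrict] at h'
    rw [LinearMap.mem_ker, map_sub, sub_eq_zero]
    exact h'.symm
  · rw [sub_sub_cancel]
    have h1 : ‖g (T.rangeRestrict x)‖ ≤ ‖g'‖ * ‖T.rangeRestrict x‖ := g'.le_opNorm _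
    have h2 : ‖T.rangeRestrict x‖ = ‖T x‖ := rfl
    rw [h2] at h1
    nlinarith [norm_nonneg (T x)]

theorem Matrix.exists_norm_mulVec_le (B : Matrix V V ℝ) :
    ∃ L > 0, ∀ x, ‖B.mulVec x‖ ≤ L * ‖x‖ := by
  let f := LinearMap.toContinuousLinearMap B.mulVecLin
  refine ⟨‖f‖ + 1, by positivity, fun x => ?_⟩
  have h : ‖B.mulVec x‖ ≤ ‖f‖ * ‖x‖ := f.le_opNorm x
  nlinarith [norm_nonneg x]

/-- The vector field `- d x + u S(B x)` for a general coupling matrix `B`. -/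
def couplingField (S : ℝ → ℝ) (d : ℝ) (B : Matrix V V ℝ) (u : ℝ) (x : V → ℝ) : V → ℝ :=
  fun i => -d * x i + u * S (B.mulVec x i)

variable {S : ℝ → ℝ} {B : Matrix V V ℝ} {d μ : ℝ}

theorem couplingField_eq_zero_iff {u : ℝ} {x : V → ℝ} :
    couplingField S d B u x = 0 ↔ ∀ i, d * x i = u * S (B.mulVec x i) := by
  rw [funext_iff]
  refine forall_congr' fun i => ?_
  simp only [couplingField, Pi.zero_apply]
  constructor <;> intro h <;> linarith

theorem eventually_norm_mulVec_lt (B : Matrix V V ℝ) (u₀ : ℝ) {ρ : ℝ} (hρ : 0 < ρ) :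
    ∀ᶠ p : ℝ × (V → ℝ) in 𝓝 (u₀, 0), ‖B.mulVec p.2‖ < ρ := by
  have hc : Continuous fun p : ℝ × (V → ℝ) => ‖B.mulVec p.2‖ :=
    (continuous_const.matrix_mulVec continuous_snd).norm
  exact (hc.tendsto _).eventually (gt_mem_nhds (by simpa using hρ))

/-- Nonzero equilibria near the bifurcation point are almost in the kernel of `μ - B`. -/
theorem IsOddSaturating.eventually_norm_smul_sub_mulVec_le (hS : IsOddSaturating S)
    (hd : 0 < d) (hμ : 0 < μ) {δ : ℝ} (hδ : 0 < δ) :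
    ∀ᶠ p : ℝ × (V → ℝ) in 𝓝 (d / μ, 0), couplingField S d B p.1 p.2 = 0 →
      ‖μ • p.2 - B.mulVec p.2‖ ≤ δ * ‖p.2‖ := by
  obtain ⟨L, hL, hBL⟩ := B.exists_norm_mulVec_le
  obtain ⟨ρ, hρ, hSρ⟩ := hS.exists_abs_sub_sub_le (δ := δ / (2 * L)) (by positivity)
  filter_upwards [eventually_abs_sub_div_le (0 : V → ℝ) hd hμ (half_pos hδ),
    eventually_norm_mulVec_lt B (d / μ) hρ] with p hp hpρ hx
  obtain ⟨u, x⟩ := p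
  rw [couplingField_eq_zero_iff] at hx
  dsimp only at *
  refine (pi_norm_le_iff_of_nonneg (by positivity)).2 fun i => ?_
  have h1 : |B.mulVec x i| ≤ L * ‖x‖ := (norm_le_pi_norm (B.mulVec x) i).trans (hBL x)
  have h2 := hSρ (B.mulVec x i) 0 ((norm_le_pi_norm (B.mulVec x) i).trans_lt hpρ)
    (by simpa using hρ)
  simp only [hS.map_zero, sub_zero] at h2
  have h3 : d / u * x i = S (B.mulVec x i) := by
    have := hx i
    have hu := hp.1
    field_simp
    linarith
  have h4 : |x i| ≤ ‖x‖ := norm_le_pi_norm x i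
  have h5 : (μ • x - B.mulVec x) i =
      (μ - d / u) * x i + (S (B.mulVec x i) - B.mulVec x i) := by
    simp only [Pi.sub_apply, Pi.smul_apply, smul_eq_mul, ← h3]
    ring
  rw [h5, Real.norm_eq_abs]
  refine (abs_add_le _ _).trans ?_
  rw [abs_mul]
  have h6 : |μ - d / u| * |x i| ≤ δ / 2 * ‖x‖ :=
    mul_le_mul hp.2 h4 (abs_nonneg _) (by positivity)
  have h7 : δ / (2 * L) * |B.mulVec x i| ≤ δ / (2 * L) * (L * ‖x‖) :=
    mul_le_mul_of_nonneg_left h1 (by positivity)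
  have h8 : δ / (2 * L) * (L * ‖x‖) = δ / 2 * ‖x‖ := by
    field_simp
  linarith

theorem IsOddSaturating.eventually_exists_norm_sub_le (hS : IsOddSaturating S)
    (hd : 0 < d) (hμ : 0 < μ) {W : Submodule ℝ (V → ℝ)}
    (hW : ∀ x, B.mulVec x = μ • x → x ∈ W) {ε : ℝ} (hε : 0 < ε) :
    ∀ᶠ p : ℝ × (V → ℝ) in 𝓝 (d / μ, 0), couplingField S d B p.1 p.2 = 0 →
      ∃ w ∈ W, ‖p.2 - w‖ ≤ ε * ‖p.2‖ := by
  obtain ⟨C, hC, hker⟩ := (μ • LinearMap.id - B.mulVecLin).exists_mem_ker_norm_sub_le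
  filter_upwards [hS.eventually_norm_smul_sub_mulVec_le (B := B) hd hμ
    (show 0 < ε / C by positivity)] with p hp hx
  obtain ⟨w, hw, hle⟩ := hker p.2
  refine ⟨w, hW w ?_, hle.trans ?_⟩
  · have : μ • w - B.mulVec w = 0 := hw
    exact (sub_eq_zero.1 this).symm
  · have h := mul_le_mul_of_nonneg_left (hp hx) hC.le
    have h2 : C * (ε / C * ‖p.2‖) = ε * ‖p.2‖ := by field_simp
    rw [h2] at h
    exact h

/-- A shrinking family of points can be selected when arbitrarily small points exist. -/
theorem exists_tendsto_zero_of_forall_eventually {ι E : Type*} [SeminormedAddCommGroup E]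
    {l : Filter ι} {r : ι → ℝ} (hr : Tendsto r l (𝓝 0)) (hr0 : ∀ᶠ i in l, 0 < r i)
    {P : ι → E → Prop} (h : ∀ ε > 0, ∀ᶠ i in l, ∃ x, P i x ∧ ‖x‖ ≤ ε) :
    ∃ x : ι → E, Tendsto x l (𝓝 0) ∧ ∀ᶠ i in l, P i (x i) := by
  -- One choice must serve every `ε`, so `x i` is taken within `r i` of the infimal norm of
  -- solutions; attainment is not needed. Without solutions the value is 0.
  have key : ∀ i, ∃ x, (0 < r i ∧ ∃ x, P i x) →
      P i x ∧ ∀ y, P i y → ‖x‖ ≤ ‖y‖ + r i := fun i => by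
    by_cases hi : 0 < r i ∧ ∃ x, P i x
    · have hne : ((fun x => ‖x‖) '' {x | P i x}).Nonempty := Set.Nonempty.image _ hi.2
      obtain ⟨_, ⟨x, hx, rfl⟩, hlt⟩ := exists_lt_of_csInf_lt hne
        (lt_add_of_pos_right (sInf ((fun x => ‖x‖) '' {x | P i x})) hi.1)
      refine ⟨x, fun _ => ⟨hx, fun y hy => hlt.le.trans ?_⟩⟩
      have : sInf ((fun x => ‖x‖) '' {x | P i x}) ≤ ‖y‖ :=
        csInf_le ⟨0, by rintro _ ⟨z, -, rfl⟩; exact norm_nonneg z⟩ ⟨y, hy, rfl⟩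
      linarith
    · exact ⟨0, fun h => absurd h hi⟩
  choose x hx using key
  refine ⟨x, ?_, ?_⟩
  · rw [Metric.tendsto_nhds]
    intro ε hε
    filter_upwards [h (ε / 3) (by positivity), hr0, hr.eventually (gt_mem_nhds (show 0 < ε / 3 by
      positivity))] with i ⟨y, hy, hle⟩ hri hlt
    have := (hx i ⟨hri, y, hy⟩).2 y hy
    rw [dist_zero_right]
    linarith
  · filter_upwards [h 1 one_pos, hr0] with i ⟨y, hy, _⟩ hri
    exact (hx i ⟨hri, y, hy⟩).1

theorem IsOddSaturating.exists_equilibria [DecidableEq V] (hS : IsOddSaturating S)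
    (hB : B.IsSymm) (hd : 0 < d) (hμ : 0 < μ) (hBμ : ∀ x, x ⬝ᵥ B.mulVec x ≤ μ * (x ⬝ᵥ x))
    {v : V → ℝ} (hv : v ≠ 0) (hBv : B.mulVec v = μ • v) :
    ∃ x : ℝ → V → ℝ, Tendsto x (𝓝[>] (d / μ)) (𝓝 0) ∧
      ∀ᶠ u in 𝓝[>] (d / μ), IsNontrivialEquilibrium (couplingField S d B u) (x u) := by
  have hr : Tendsto (fun u => u - d / μ) (𝓝[>] (d / μ)) (𝓝 0) := by
    have : Tendsto (fun u => u - d / μ) (𝓝 (d / μ)) (𝓝 (d / μ - d / μ)) :=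
      tendsto_id.sub_const _
    rw [sub_self] at this
    exact this.mono_left nhdsWithin_le_nhds
  refine exists_tendsto_zero_of_forall_eventually hr
    (eventually_mem_nhdsWithin.mono fun u hu => sub_pos.2 hu) fun ε hε => ?_
  -- The equilibrium will be `x = (u/d) S(y)`. Keeping `u/d ≤ 2/μ`, the bound `‖y‖ ≤ εμ/2` gives
  -- `‖x‖ ≤ ε`.
  obtain ⟨η, hη, h⟩ := hS.exists_fixedPoint hB hμ hBμ hv hBv
    (show 0 < ε * μ / (1 + 1) by positivity)
  have hη' : d / μ < min (d / μ * (1 + η)) (d / μ * 2) := by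
    have : 0 < d / μ := by positivity
    refine lt_min ?_ ?_ <;> nlinarith
  filter_upwards [Ioo_mem_nhdsGT hη'] with u hu
  have hu1 : d < u * μ := (div_lt_iff₀ hμ).1 hu.1
  have hu2 : u * μ < d * (1 + η) := by
    have := hu.2.trans_le (min_le_left _ _)
    rw [div_mul_eq_mul_div, lt_div_iff₀ hμ] at this
    exact this
  have hu3 : u * μ < d * 2 := by
    have := hu.2.trans_le (min_le_right _ _)
    rw [div_mul_eq_mul_div, lt_div_iff₀ hμ] at this
    exact this
  have hu0 : 0 < u := lt_trans (by positivity) hu.1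
  obtain ⟨y, hy0, hyε, hy, hSy⟩ := h (u / d)
    (by rwa [div_mul_eq_mul_div, lt_div_iff₀ hd, one_mul])
    (by rw [div_mul_eq_mul_div, div_lt_iff₀ hd]; linarith)
  have hBx : B.mulVec ((u / d) • (S ∘ y)) = y := by
    rw [Matrix.mulVec_smul]
    exact hy.symm
  refine ⟨(u / d) • (S ∘ y), ⟨fun h0 => hy0 ?_, ?_⟩, ?_⟩
  · rw [← hBx, h0, Matrix.mulVec_zero]
  · rw [couplingField_eq_zero_iff, hBx]
    intro i
    simp only [Pi.smul_apply, Function.comp_apply, smul_eq_mul]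
    field_simp
  · refine (pi_norm_le_iff_of_nonneg hε.le).2 fun i => ?_
    have h1 : |y i| ≤ ε * μ / (1 + 1) := (norm_le_pi_norm y i).trans hyε
    have h2 : u / d ≤ 2 / μ := by
      rw [div_le_div_iff₀ hd hμ]
      linarith
    have h3 : u / d * |S (y i)| ≤ 2 / μ * (ε * μ / (1 + 1)) :=
      mul_le_mul h2 ((hSy i).trans h1) (abs_nonneg _) (by positivity)
    have h4 : 2 / μ * (ε * μ / (1 + 1)) = ε := by
      field_simp
      norm_num
    simp only [Pi.smul_apply, Function.comp_apply, smul_eq_mul, Real.norm_eq_abs, abs_mul,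
      abs_of_pos (div_pos hu0 hd)]
    linarith

theorem IsOddSaturating.hasBifurcationAlong [DecidableEq V] (hS : IsOddSaturating S)
    (hB : B.IsSymm) (hd : 0 < d) (hμ : 0 < μ) (hBμ : ∀ x, x ⬝ᵥ B.mulVec x ≤ μ * (x ⬝ᵥ x))
    {v : V → ℝ} (hv : v ≠ 0) (hBv : B.mulVec v = μ • v) {W : Submodule ℝ (V → ℝ)}
    (hW : ∀ x, B.mulVec x = μ • x → x ∈ W) :
    HasBifurcationAlong (couplingField S d B) (d / μ) W := by
  refine ⟨fun u => ?_, hS.exists_equilibria hB hd hμ hBμ hv hBv, fun ε hε => ?_⟩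
  · rw [couplingField_eq_zero_iff]
    simp [hS.map_zero]
  · exact (hS.eventually_exists_norm_sub_le hd hμ hW hε).mono fun p hp hx => hp hx.2

/-- If the critical eigenspace is the consensus space, equilibria near the bifurcation point are
exact consensus vectors. -/
theorem IsOddSaturating.eventually_mem_consensusSpace [Nonempty V] (hS : IsOddSaturating S)
    (hB : B.IsSymm) (hd : 0 < d) (hμ : 0 < μ) (hB1 : B.mulVec (fun _ => 1) = fun _ => μ)
    (hker : ∀ x, B.mulVec x = μ • x → x ∈ consensusSpace V) :
    ∀ᶠ p : ℝ × (V → ℝ) in 𝓝 (d / μ, 0), couplingField S d B p.1 p.2 = 0 →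
      ∃ c, p.2 = fun _ => c := by
  obtain ⟨L, hL, hBL⟩ := B.exists_norm_mulVec_le
  obtain ⟨C, hC, hkerC⟩ := (μ • LinearMap.id - B.mulVecLin).exists_mem_ker_norm_sub_le
  -- In units of `‖z‖/C`, the bound on `(μ - B)z` will be 1/8 from `μ - d/u`, 1/16 from the
  -- remainder `D` and 1/16 from `s`: in total 1/4.
  obtain ⟨ρ, hρ, hSρ⟩ := hS.exists_abs_sub_sub_le (δ := 1 / (16 * C * L)) (by positivity)
  have hmean : ∀ᶠ p : ℝ × (V → ℝ) in 𝓝 (d / μ, 0),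
      |μ * ((∑ i, p.2 i) / Fintype.card V)| < ρ := by
    have hc : Continuous fun p : ℝ × (V → ℝ) => |μ * ((∑ i, p.2 i) / Fintype.card V)| := by
      fun_prop
    exact (hc.tendsto _).eventually (gt_mem_nhds (by simpa using hρ))
  filter_upwards [eventually_abs_sub_div_le (0 : V → ℝ) hd hμ (show 0 < 1 / (8 * C) by positivity),
    eventually_norm_mulVec_lt B (d / μ) hρ, hmean] with p hp hpρ hm hx
  obtain ⟨u, x⟩ := p
  rw [couplingField_eq_zero_iff] at hx
  dsimp only at *
  obtain ⟨hu, hμu⟩ := hp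
  have hn : (0 : ℝ) < Fintype.card V := by positivity
  set c := (∑ i, x i) / Fintype.card V with hc
  refine ⟨c, ?_⟩
  set z : V → ℝ := x - fun _ => c with hz
  have hB1c : ∀ a : ℝ, B.mulVec (fun _ => a) = fun _ => μ * a := fun a => by
    have : (fun _ : V => a) = a • fun _ => (1 : ℝ) := by ext; simp
    rw [this, Matrix.mulVec_smul, hB1]
    ext
    simp [mul_comm]
  have hzsum : ∑ i, z i = 0 := by
    simp only [hz, Pi.sub_apply, Finset.sum_sub_distrib, Finset.sum_const, Finset.card_univ,
      nsmul_eq_mul, hc]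
    field_simp
    ring
  have hBzsum : ∑ i, B.mulVec z i = 0 := by
    have h : (fun _ => (1 : ℝ)) ⬝ᵥ B.mulVec z = (fun _ => μ) ⬝ᵥ z := by
      rw [Matrix.dotProduct_mulVec, ← Matrix.mulVec_transpose, hB.eq, hB1]
    simpa [dotProduct, ← Finset.mul_sum, hzsum] using h
  have hBz : ∀ i, B.mulVec z i = B.mulVec x i - μ * c := fun i => by
    rw [hz, Matrix.mulVec_sub, hB1c]
    rfl
  -- `D` is the nonlinear remainder of `S` around the constant `μ c`; `s` is the defect of the
  -- constant vector `c` as an equilibrium, the same for every agent.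
  set D : V → ℝ := fun i => S (B.mulVec x i) - S (μ * c) - B.mulVec z i with hD
  set s : ℝ := S (μ * c) - d / u * c with hs
  set b : ℝ := 1 / (16 * C) * ‖z‖ with hb
  have hDb : ∀ i, |D i| ≤ b := fun i => by
    have h1 := hSρ (B.mulVec x i) (μ * c) ((norm_le_pi_norm (B.mulVec x) i).trans_lt hpρ) hm
    rw [← hBz] at h1
    have h2 : |B.mulVec z i| ≤ L * ‖z‖ := (norm_le_pi_norm (B.mulVec z) i).trans (hBL z)
    have h3 := mul_le_mul_of_nonneg_left h2 (show 0 ≤ 1 / (16 * C * L) by positivity)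
    have h4 : 1 / (16 * C * L) * (L * ‖z‖) = b := by
      rw [hb]
      field_simp
    linarith
  have heq : ∀ i, d / u * z i - B.mulVec z i = D i + s := fun i => by
    have h1 : d / u * x i = S (B.mulVec x i) := by
      have := hx i
      field_simp
      linarith
    simp only [hD, hs, hz, Pi.sub_apply, mul_sub, h1]
    ring
  -- Summing over agents kills both `z` and `B z`, so `s` is minus the mean of `D`.
  have hsb : |s| ≤ b := by
    have h1 : ∑ i, D i + Fintype.card V * s = 0 := by
      have : ∑ i, (d / u * z i - B.mulVec z i) = ∑ i, (D i + s) :=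
        Finset.sum_congr rfl fun i _ => heq i
      rw [Finset.sum_sub_distrib, ← Finset.mul_sum, hzsum, hBzsum, Finset.sum_add_distrib] at this
      simpa using this.symm
    have h2 : |∑ i, D i| ≤ Fintype.card V * b := by
      refine (Finset.abs_sum_le_sum_abs _ _).trans ?_
      simpa using Finset.sum_le_card_nsmul Finset.univ _ _ fun i _ => hDb i
    have h3 : ∑ i, D i = -(Fintype.card V * s) := by linarith
    rw [h3, abs_neg, abs_mul, abs_of_pos hn] at h2
    exact le_of_mul_le_mul_left h2 hn
  have hTz : ‖μ • z - B.mulVec z‖ ≤ 1 / (4 * C) * ‖z‖ := by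
    refine (pi_norm_le_iff_of_nonneg (by positivity)).2 fun i => ?_
    have h5 : (μ • z - B.mulVec z) i = (μ - d / u) * z i + (D i + s) := by
      rw [← heq]
      simp only [Pi.sub_apply, Pi.smul_apply, smul_eq_mul]
      ring
    have h6 : |μ - d / u| * |z i| ≤ 1 / (8 * C) * ‖z‖ :=
      mul_le_mul hμu (norm_le_pi_norm z i) (abs_nonneg _) (by positivity)
    have h7 : 1 / (8 * C) * ‖z‖ + (b + b) = 1 / (4 * C) * ‖z‖ := by
      rw [hb]
      field_simp
      ring
    rw [h5, Real.norm_eq_abs]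
    have h8 := abs_add_le ((μ - d / u) * z i) (D i + s)
    have h9 := abs_add_le (D i) s
    rw [abs_mul] at h8
    linarith [hDb i]
  obtain ⟨w, hw, hwz⟩ := hkerC z
  have hw0 : μ • w - B.mulVec w = 0 := hw
  obtain ⟨a, rfl⟩ := Submodule.mem_span_singleton.1 (hker w (sub_eq_zero.1 hw0).symm)
  have hwz' : ‖z - a • fun _ => (1 : ℝ)‖ ≤ 1 / 4 * ‖z‖ := by
    have h1 : ‖z - a • fun _ => (1 : ℝ)‖ ≤ C * ‖μ • z - B.mulVec z‖ := hwz
    have h2 := mul_le_mul_of_nonneg_left hTz hC.le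
    have h3 : C * (1 / (4 * C) * ‖z‖) = 1 / 4 * ‖z‖ := by field_simp
    linarith
  -- As `z` has mean 0, the mean of `z - a` is `-a`. With the previous bound this gives `‖z‖ ≤
  -- ‖z‖/2`, hence `z = 0`.
  have ha : |a| ≤ 1 / 4 * ‖z‖ := by
    have h1 : |∑ i, (z i - a)| ≤ Fintype.card V * (1 / 4 * ‖z‖) := by
      refine (Finset.abs_sum_le_sum_abs _ _).trans ?_
      have : ∀ i ∈ Finset.univ, |z i - a| ≤ 1 / 4 * ‖z‖ := fun i _ => by
        have := (norm_le_pi_norm (z - a • fun _ => (1 : ℝ)) i).trans hwz'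
        simpa using this
      simpa using Finset.sum_le_card_nsmul _ _ _ this
    rw [Finset.sum_sub_distrib, hzsum, zero_sub, abs_neg, Finset.sum_const, Finset.card_univ,
      nsmul_eq_mul, abs_mul, abs_of_pos hn] at h1
    exact le_of_mul_le_mul_left h1 hn
  have hz0 : ‖z‖ ≤ 1 / 2 * ‖z‖ := by
    refine (pi_norm_le_iff_of_nonneg (by positivity)).2 fun i => ?_
    have h1 : |z i - a| ≤ 1 / 4 * ‖z‖ := by
      have := (norm_le_pi_norm (z - a • fun _ => (1 : ℝ)) i).trans hwz'
      simpa using this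
    have h2 := abs_add_le (z i - a) a
    rw [sub_add_cancel] at h2
    rw [Real.norm_eq_abs]
    linarith
  have hz00 : z = 0 := norm_eq_zero.1 (by linarith [norm_nonneg z])
  exact sub_eq_zero.1 hz00

end Bifurcation

/-! ### Spectral facts for regular graphs. -/

theorem adjMatrix_mulVec_one_of_regular {V : Type*} [Fintype V] {G : SimpleGraph V}
    [DecidableRel G.Adj] {K : ℕ} (hreg : G.IsRegularOfDegree K) :
    (G.adjMatrix ℝ).mulVec (fun _ => 1) = (K : ℝ) • fun _ => 1 := by
  ext i
  rw [SimpleGraph.adjMatrix_mulVec_apply]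
  simp [hreg i]

section Graph

variable {V : Type*} [DecidableEq V] (G : SimpleGraph V) [DecidableRel G.Adj]

/-- The coupling matrix `α + γ A` of the opinion dynamics. -/
def couplingMatrix (α γ : ℝ) : Matrix V V ℝ :=
  α • 1 + γ • G.adjMatrix ℝ

theorem couplingMatrix_isSymm (α γ : ℝ) : (couplingMatrix G α γ).IsSymm := by
  simp [couplingMatrix, Matrix.IsSymm, G.isSymm_adjMatrix.eq]

variable [Fintype V]

theorem couplingMatrix_mulVec (α γ : ℝ) (x : V → ℝ) :
    (couplingMatrix G α γ).mulVec x = α • x + γ • (G.adjMatrix ℝ).mulVec x := by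
  rw [couplingMatrix, Matrix.add_mulVec, Matrix.smul_mulVec, Matrix.smul_mulVec, Matrix.one_mulVec]

theorem unbiasedField_eq_couplingField (S : ℝ → ℝ) (d α γ : ℝ) :
    unbiasedField S d α γ G = couplingField S d (couplingMatrix G α γ) := by
  ext u x i
  have h : ∑ k ∈ Finset.univ.erase i, G.adjMatrix ℝ i k * x k = (G.adjMatrix ℝ).mulVec x i := by
    rw [Matrix.mulVec, dotProduct, ← Finset.add_sum_erase _ _ (Finset.mem_univ i)]
    simp
  change -d * x i + u * S (α * x i + γ * ∑ k ∈ Finset.univ.erase i, G.adjMatrix ℝ i k * x k) + 0 =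
    -d * x i + u * S ((couplingMatrix G α γ).mulVec x i)
  rw [h, add_zero, couplingMatrix_mulVec]
  rfl

/-- For symmetric `N = A - lam`, `N²y = 0` gives `Ny ⬝ᵥ Ny = 0`, so powers of `N` have no larger
kernel. -/
theorem mem_genEigenspace_iff {lam : ℝ} {x : V → ℝ} :
    x ∈ genEigenspace G lam ↔ (G.adjMatrix ℝ).mulVec x = lam • x := by
  set N : Matrix V V ℝ := G.adjMatrix ℝ - lam • 1 with hN
  have hNs : N.IsSymm := by
    simp [hN, Matrix.IsSymm, G.isSymm_adjMatrix.eq]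
  have hNlin : Matrix.toLin' (G.adjMatrix ℝ) - lam • (1 : Module.End ℝ (V → ℝ)) =
      Matrix.toLin' N := by
    rw [hN, map_sub, map_smul, Matrix.toLin'_one]
    rfl
  have hsq : ∀ y : V → ℝ, N.mulVec (N.mulVec y) = 0 → N.mulVec y = 0 := fun y hy => by
    have : N.mulVec y ⬝ᵥ N.mulVec y = 0 := by
      rw [Matrix.dotProduct_mulVec, ← Matrix.mulVec_transpose, hNs.eq, hy, zero_dotProduct]
    exact dotProduct_self_eq_zero.1 this
  have hpow : ∀ k : ℕ, ∀ y : V → ℝ, (Matrix.toLin' N ^ k) y = 0 → N.mulVec y = 0 := by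
    intro k
    induction k with
    | zero =>
      intro y hy
      rw [pow_zero, Module.End.one_apply] at hy
      rw [hy, Matrix.mulVec_zero]
    | succ k ih =>
      intro y hy
      rw [pow_succ, Module.End.mul_apply, Matrix.toLin'_apply] at hy
      exact hsq y (ih _ hy)
  have hmem : N.mulVec x = 0 ↔ (G.adjMatrix ℝ).mulVec x = lam • x := by
    rw [hN, Matrix.sub_mulVec, Matrix.smul_mulVec, Matrix.one_mulVec, sub_eq_zero]
  rw [genEigenspace, Module.End.mem_maxGenEigenspace, ← hmem, hNlin]
  refine ⟨fun ⟨k, hk⟩ => hpow k x hk, fun h => ⟨1, ?_⟩⟩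
  rw [pow_one, Matrix.toLin'_apply, h]

theorem mem_spectrum_adjMatrix_iff {lam : ℝ} :
    lam ∈ spectrum ℝ (G.adjMatrix ℝ) ↔ ∃ x ≠ 0, (G.adjMatrix ℝ).mulVec x = lam • x := by
  rw [← Matrix.spectrum_toLin', ← Module.End.hasEigenvalue_iff_mem_spectrum]
  constructor
  · intro h
    obtain ⟨x, hx⟩ := h.exists_hasEigenvector
    exact ⟨x, hx.2, by simpa using hx.apply_eq_smul⟩
  · rintro ⟨x, hx0, hx⟩
    exact Module.End.hasEigenvalue_of_hasEigenvector
      ⟨Module.End.mem_eigenspace_iff.2 (by simpa using hx), hx0⟩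

theorem lamMin_mul_le_dotProduct [Nonempty V] (x : V → ℝ) :
    lamMin G * (x ⬝ᵥ x) ≤ x ⬝ᵥ (G.adjMatrix ℝ).mulVec x := by
  have h : (G.adjMatrix ℝ - algebraMap ℝ (Matrix V V ℝ) (lamMin G)).PosSemidef := by
    refine Matrix.posSemidef_iff_isHermitian_and_spectrum_nonneg.2 ⟨?_, ?_⟩
    · refine (G.isHermitian_adjMatrix ℝ).sub ?_
      rw [Algebra.algebraMap_eq_smul_one]
      simp [Matrix.IsHermitian]
    · rw [← spectrum.sub_singleton_eq]
      rintro _ ⟨a, ha, b, rfl, rfl⟩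
      exact sub_nonneg.2 ((lamMax_lamMin_spec G).2.2 ha)
  have h2 := h.dotProduct_mulVec_nonneg x
  rw [star_trivial, Algebra.algebraMap_eq_smul_one, Matrix.sub_mulVec, Matrix.smul_mulVec,
    Matrix.one_mulVec, dotProduct_sub, dotProduct_smul, smul_eq_mul] at h2
  linarith

/-- The Rayleigh quotient at a basis vector is a diagonal entry, which is 0 in the absence of loops.
-/
theorem lamMin_nonpos [Nonempty V] : lamMin G ≤ 0 := by
  obtain ⟨i⟩ := ‹Nonempty V›
  have : Nonempty V := ⟨i⟩
  have := lamMin_mul_le_dotProduct G (Pi.single i 1)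
  simpa using this

variable {G} {K : ℕ}

theorem lapMatrix_mulVec_of_regular (hreg : G.IsRegularOfDegree K) (x : V → ℝ) :
    (G.lapMatrix ℝ).mulVec x = (K : ℝ) • x - (G.adjMatrix ℝ).mulVec x := by
  ext i
  rw [SimpleGraph.lapMatrix_mulVec_apply, hreg i, Pi.sub_apply, SimpleGraph.adjMatrix_mulVec_apply]
  simp

/-- By regularity `K - A` is the Laplacian, which is positive semidefinite. -/
theorem dotProduct_adjMatrix_mulVec_le (hreg : G.IsRegularOfDegree K) (x : V → ℝ) :
    x ⬝ᵥ (G.adjMatrix ℝ).mulVec x ≤ K * (x ⬝ᵥ x) := by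
  have h := (G.posSemidef_lapMatrix ℝ).dotProduct_mulVec_nonneg x
  rw [star_trivial, lapMatrix_mulVec_of_regular hreg, dotProduct_sub, dotProduct_smul,
    smul_eq_mul] at h
  linarith

theorem lamMax_eq_of_regular [Nonempty V] (hreg : G.IsRegularOfDegree K) : lamMax G = K := by
  refine (lamMax_lamMin_spec G).1.unique ⟨?_, fun lam hlam => ?_⟩
  · exact (mem_spectrum_adjMatrix_iff G).2
      ⟨fun _ => 1, fun h => one_ne_zero (congrFun h (Classical.arbitrary V)),
        adjMatrix_mulVec_one_of_regular hreg⟩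
  · obtain ⟨x, hx0, hx⟩ := (mem_spectrum_adjMatrix_iff G).1 hlam
    have h := dotProduct_adjMatrix_mulVec_le hreg x
    rw [hx, dotProduct_smul, smul_eq_mul] at h
    have hpos : 0 < x ⬝ᵥ x := by
      simpa using Matrix.dotProduct_star_self_pos_iff.2 hx0
    exact le_of_mul_le_mul_right h hpos

theorem genEigenspace_lamMax [Nonempty V] (hconn : G.Connected) (hreg : G.IsRegularOfDegree K) :
    genEigenspace G (lamMax G) = consensusSpace V := by
  ext x
  rw [mem_genEigenspace_iff, lamMax_eq_of_regular hreg, consensusSpace,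
    Submodule.mem_span_singleton]
  constructor
  · intro h
    have h0 : (G.lapMatrix ℝ).mulVec x = 0 := by
      rw [lapMatrix_mulVec_of_regular hreg, h, sub_self]
    have h1 := (G.lapMatrix_mulVec_eq_zero_iff_forall_reachable).1 h0
    refine ⟨x (Classical.arbitrary V), ?_⟩
    ext i
    simpa using h1 _ _ (hconn.preconnected _ i)
  · rintro ⟨a, rfl⟩
    rw [Matrix.mulVec_smul, adjMatrix_mulVec_one_of_regular hreg, smul_comm]

/-- Pairing `A x = lamMin x` with the all-ones vector gives `lamMin ∑ x = K ∑ x`, while `lamMin ≤ 0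
< K`. -/
theorem genEigenspace_lamMin_le [Nontrivial V] (hconn : G.Connected)
    (hreg : G.IsRegularOfDegree K) : genEigenspace G (lamMin G) ≤ dissensusSpace V := by
  intro x hx
  rw [mem_genEigenspace_iff] at hx
  have hK : 0 < (K : ℝ) := by
    obtain ⟨i⟩ := hconn.nonempty
    have := hconn.preconnected.degree_pos_of_nontrivial i
    rw [hreg i] at this
    exact_mod_cast this
  have h : (fun _ => (1 : ℝ)) ⬝ᵥ (G.adjMatrix ℝ).mulVec x = K * ∑ i, x i := by
    rw [Matrix.dotProduct_mulVec, ← Matrix.mulVec_transpose, G.isSymm_adjMatrix.eq,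
      adjMatrix_mulVec_one_of_regular hreg, smul_dotProduct]
    simp [dotProduct]
  rw [hx, dotProduct_smul, smul_eq_mul] at h
  simp only [dotProduct, one_mul] at h
  change ∑ i, x i = 0
  have hl := lamMin_nonpos G
  have : (K - lamMin G) * ∑ i, x i = 0 := by linarith
  rcases mul_eq_zero.1 this with h' | h'
  · linarith
  · exact h'

end Graph

/-! ### From tangency to consensus and dissensus states. -/

section Dissensus

variable {V : Type*} [Fintype V]

/-- If every entry were at least `-‖x‖/n`, the entry `x j = ‖x‖` would force the sum up to `‖x‖ -
(n-1)‖x‖/n = ‖x‖/n`. -/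
theorem exists_opposite_of_sum_small_aux {x : V → ℝ} (hn : 2 ≤ Fintype.card V) (hx : x ≠ 0)
    (hsum : |∑ i, x i| * Fintype.card V < ‖x‖) {j : V} (hj : x j = ‖x‖) :
    ∃ i k, ‖x‖ < x i * Fintype.card V ∧ x k * Fintype.card V < -‖x‖ := by
  classical
  have hn' : (2 : ℝ) ≤ Fintype.card V := by exact_mod_cast hn
  have hpos : 0 < ‖x‖ := norm_pos_iff.2 hx
  refine ⟨j, ?_⟩
  by_contra! h
  have h1 : ∀ k, -‖x‖ ≤ x k * Fintype.card V := fun k => h k (by rw [hj]; nlinarith)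
  have h2 : ∑ k ∈ Finset.univ.erase j, -‖x‖ ≤
      ∑ k ∈ Finset.univ.erase j, x k * Fintype.card V := Finset.sum_le_sum fun k _ => h1 k
  have h3 : ∑ k, x k = x j + ∑ k ∈ Finset.univ.erase j, x k :=
    (Finset.add_sum_erase _ _ (Finset.mem_univ j)).symm
  rw [← Finset.sum_mul, Finset.sum_const, Finset.card_erase_of_mem (Finset.mem_univ j),
    Finset.card_univ, nsmul_eq_mul, Nat.cast_sub (by omega), Nat.cast_one] at h2
  have h4 := mul_le_mul_of_nonneg_right (le_abs_self (∑ k, x k))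
    (show 0 ≤ (Fintype.card V : ℝ) by positivity)
  rw [h3, add_mul, hj] at h4
  rw [h3, hj] at hsum
  nlinarith

/-- A nonzero vector whose entries almost cancel has large entries of both signs. -/
theorem exists_opposite_of_sum_small {x : V → ℝ} (hn : 2 ≤ Fintype.card V) (hx : x ≠ 0)
    (hsum : |∑ i, x i| * Fintype.card V < ‖x‖) :
    ∃ i k, ‖x‖ < x i * Fintype.card V ∧ x k * Fintype.card V < -‖x‖ := by
  have hne : Nonempty V := Fintype.card_pos_iff.1 (by omega)
  obtain ⟨j, -, hmax⟩ := Finset.exists_max_image Finset.univ (fun i => |x i|)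
    Finset.univ_nonempty
  have hj : |x j| = ‖x‖ := le_antisymm (norm_le_pi_norm x j)
    ((pi_norm_le_iff_of_nonneg (abs_nonneg _)).2 fun i => hmax i (Finset.mem_univ i))
  rcases abs_choice (x j) with h | h
  · exact exists_opposite_of_sum_small_aux hn hx hsum (h.symm.trans hj)
  · obtain ⟨i, k, hi, hk⟩ := exists_opposite_of_sum_small_aux (x := -x) hn (neg_ne_zero.2 hx)
      (by simpa using hsum) (j := j) (by rw [norm_neg]; exact h.symm.trans hj)
    simp only [norm_neg, Pi.neg_apply] at hi hk
    exact ⟨k, i, by linarith, by linarith⟩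

theorem abs_sum_le_of_norm_sub_le {x w : V → ℝ} (hw : w ∈ dissensusSpace V) {r : ℝ}
    (h : ‖x - w‖ ≤ r) : |∑ i, x i| ≤ Fintype.card V * r := by
  have hw0 : ∑ i, w i = 0 := hw
  have h1 : ∑ i, x i = ∑ i, (x - w) i := by
    simp [Finset.sum_sub_distrib, hw0]
  rw [h1]
  refine (Finset.abs_sum_le_sum_abs _ _).trans ?_
  simpa using Finset.sum_le_card_nsmul Finset.univ _ _ fun i _ =>
    (norm_le_pi_norm (x - w) i).trans h

/-- Nonzero equilibria asymptotically tangent to the dissensus space are dissensus states. -/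
theorem HasBifurcationAlong.eventually_isDissensusState [Nontrivial V]
    {F : ℝ → (V → ℝ) → (V → ℝ)} {u₀ : ℝ} {W : Submodule ℝ (V → ℝ)}
    (hF : HasBifurcationAlong F u₀ W) (hW : W ≤ dissensusSpace V) {ε : ℝ} (hε : 0 < ε) :
    ∀ᶠ p : ℝ × (V → ℝ) in 𝓝 (u₀, 0), IsNontrivialEquilibrium (F p.1) p.2 →
      ∀ θ, ε * ‖p.2‖ ≤ θ → IsDissensusState θ p.2 ∧
        (θ * Fintype.card V ≤ ‖p.2‖ → ∃ i k, θ < p.2 i ∧ p.2 k < -θ) := by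
  have hn : 2 ≤ Fintype.card V := Fintype.one_lt_card
  set n : ℝ := (Fintype.card V : ℝ) with hndef
  have hn0 : 0 < n := by positivity
  -- The `ε` bounds the average opinion. The `1/n²` yields `|∑ x| n < ‖x‖`: one factor `n` comes
  -- from summing, the other from the opposite-signs lemma. Halving makes both strict.
  filter_upwards [hF.2.2 (min ε (1 / n ^ 2) / 2) (by positivity)] with p hp hx θ hθ
  obtain ⟨w, hw, hle⟩ := hp hx
  have hpos : 0 < ‖p.2‖ := norm_pos_iff.2 hx.1
  have hsum := abs_sum_le_of_norm_sub_le (hW hw) hle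
  have h1 : n * (min ε (1 / n ^ 2) / 2 * ‖p.2‖) < n * (ε * ‖p.2‖) := by
    have : min ε (1 / n ^ 2) / 2 < ε := by linarith [min_le_left ε (1 / n ^ 2)]
    gcongr
  have h2 : n * (min ε (1 / n ^ 2) / 2 * ‖p.2‖) < n * (1 / n ^ 2 * ‖p.2‖) := by
    have h0 : 0 < 1 / n ^ 2 := by positivity
    have : min ε (1 / n ^ 2) / 2 < 1 / n ^ 2 := by linarith [min_le_right ε (1 / n ^ 2)]
    gcongr
  have h3 : n * (1 / n ^ 2 * ‖p.2‖) * n = ‖p.2‖ := by field_simp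
  obtain ⟨i, k, hi, hk⟩ := exists_opposite_of_sum_small hn hx.1
    (h3 ▸ mul_lt_mul_of_pos_right (hsum.trans_lt h2) hn0)
  refine ⟨⟨⟨i, k, ?_, ?_⟩, ?_⟩, fun hθn => ⟨i, k, ?_, ?_⟩⟩
  · exact pos_of_mul_pos_left (hpos.trans hi) hn0.le
  · exact neg_of_mul_neg_left (hk.trans (neg_neg_of_pos hpos)) hn0.le
  · have h4 := mul_le_mul_of_nonneg_left hθ hn0.le
    rw [mul_comm θ]
    exact (hsum.trans_lt h1).trans_le h4
  · exact lt_of_mul_lt_mul_right (hθn.trans_lt hi) hn0.le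
  · refine lt_of_mul_lt_mul_right (?_ : p.2 k * n < -θ * n) hn0.le
    linarith

theorem eventually_norm_snd_lt {E : Type*} [NormedAddCommGroup E] (u₀ : ℝ) {θ : ℝ} (hθ : 0 < θ) :
    ∀ᶠ p : ℝ × E in 𝓝 (u₀, 0), ‖p.2‖ < θ :=
  (continuous_snd.norm.tendsto _).eventually (gt_mem_nhds (by simpa using hθ))

/-- Nonzero exact consensus vectors are consensus states for every admissible threshold. -/
theorem isConsensusState_const {V : Type*} [Fintype V] [Nonempty V] {c : ℝ}
    (hc : (fun _ : V => c) ≠ 0) :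
    SameSign (fun _ : V => c) ∧ ∀ θ > 0, θ < ‖fun _ : V => c‖ →
      IsConsensusState θ fun _ : V => c := by
  have hc0 : c ≠ 0 := by
    rintro rfl
    exact hc rfl
  have hs : SameSign (fun _ : V => c) := ⟨fun _ => hc0, fun _ _ => rfl⟩
  refine ⟨hs, fun θ hθ hlt => ⟨⟨fun _ => ?_, hs⟩, fun _ _ => by simpa using hθ⟩⟩
  rwa [pi_norm_const, Real.norm_eq_abs] at hlt

end Dissensus

/-! ### Transfer from the coupling matrix to the graph, and assembly. -/

section CriticalEigenvalue

variable {V : Type*} [Fintype V] [DecidableEq V] {G : SimpleGraph V} [DecidableRel G.Adj]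

theorem couplingMatrix_mulVec_eq_iff {α γ lam : ℝ} (hγ : γ ≠ 0) {x : V → ℝ} :
    (couplingMatrix G α γ).mulVec x = (α + γ * lam) • x ↔ x ∈ genEigenspace G lam := by
  rw [mem_genEigenspace_iff, couplingMatrix_mulVec, add_smul, mul_smul, add_right_inj,
    (smul_right_injective _ hγ).eq_iff]

/-- Keeping the factor `γ` in `hle` treats both extremes at once: `lam` is the top of the spectrum
for `γ > 0` and the bottom for `γ < 0`. -/
theorem IsOddSaturating.hasBifurcationAlong_genEigenspace {S : ℝ → ℝ} (hS : IsOddSaturating S)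
    {d α γ lam : ℝ} (hd : 0 < d) (hγ : γ ≠ 0) (hpos : 0 < α + γ * lam)
    (hlam : lam ∈ spectrum ℝ (G.adjMatrix ℝ))
    (hle : ∀ x : V → ℝ, γ * (x ⬝ᵥ (G.adjMatrix ℝ).mulVec x) ≤ γ * (lam * (x ⬝ᵥ x))) :
    HasBifurcationAlong (unbiasedField S d α γ G) (d / (α + γ * lam)) (genEigenspace G lam) := by
  obtain ⟨v, hv, hAv⟩ := (mem_spectrum_adjMatrix_iff G).1 hlam
  rw [unbiasedField_eq_couplingField]
  refine hS.hasBifurcationAlong (couplingMatrix_isSymm G α γ) hd hpos (fun x => ?_) hv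
    ((couplingMatrix_mulVec_eq_iff hγ).2 ((mem_genEigenspace_iff G).2 hAv))
    fun x hx => (couplingMatrix_mulVec_eq_iff hγ).1 hx
  rw [couplingMatrix_mulVec, dotProduct_add, dotProduct_smul, dotProduct_smul, smul_eq_mul,
    smul_eq_mul]
  linarith [hle x]

end CriticalEigenvalue

theorem theorem2 {V : Type*} [Fintype V] [DecidableEq V] [Nontrivial V]
    (G : SimpleGraph V) [DecidableRel G.Adj] (K : ℕ)
    (hconn : G.Connected) (hreg : G.IsRegularOfDegree K)
    (S : ℝ → ℝ) (hS : IsOddSaturating S)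
    (d α γ : ℝ) (hd : 0 < d) (hα : 0 < α) :
    -- the critical eigenspaces
    genEigenspace G (lamMax G) = consensusSpace V ∧
    genEigenspace G (lamMin G) ≤ dissensusSpace V ∧
    -- the agreement bifurcation produces consensus
    (0 < γ → ∀ ua : ℝ, ua = d / (α + γ * lamMax G) →
      0 < α + γ * lamMax G ∧
      HasBifurcationAlong (unbiasedField S d α γ G) ua (genEigenspace G (lamMax G)) ∧
      ∀ᶠ p : ℝ × (V → ℝ) in 𝓝 (ua, 0),
        IsNontrivialEquilibrium (unbiasedField S d α γ G p.1) p.2 →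
          SameSign p.2 ∧
          (∀ θ > 0, ∀ i k, |p.2 i - p.2 k| < θ) ∧
          (∀ θ > 0, θ < ‖p.2‖ → IsConsensusState θ p.2)) ∧
    -- the disagreement bifurcation produces dissensus
    (γ < 0 → ∀ ud : ℝ, ud = d / (α + γ * lamMin G) →
      0 < α + γ * lamMin G ∧
      HasBifurcationAlong (unbiasedField S d α γ G) ud (genEigenspace G (lamMin G)) ∧
      (∀ θ > 0, ∀ᶠ p : ℝ × (V → ℝ) in 𝓝 (ud, 0),
        IsNontrivialEquilibrium (unbiasedField S d α γ G p.1) p.2 →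
          IsDissensusState θ p.2) ∧
      (∀ ε > 0, ∀ᶠ p : ℝ × (V → ℝ) in 𝓝 (ud, 0),
        IsNontrivialEquilibrium (unbiasedField S d α γ G p.1) p.2 →
          ∀ θ, ε * ‖p.2‖ ≤ θ →
            IsDissensusState θ p.2 ∧
            (θ * Fintype.card V ≤ ‖p.2‖ → ∃ i k, θ < p.2 i ∧ p.2 k < -θ))) := by
  
  have hmax : lamMax G = K := lamMax_eq_of_regular hreg
  have hWmax := genEigenspace_lamMax hconn hreg
  have hWmin := genEigenspace_lamMin_le hconn hreg
  refine ⟨hWmax, hWmin, ?_, ?_⟩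
  · rintro hγ _ rfl
    have hpos : 0 < α + γ * lamMax G := by
      rw [hmax]
      positivity
    refine ⟨hpos, hS.hasBifurcationAlong_genEigenspace hd hγ.ne' hpos
      (lamMax_lamMin_spec G).1.1 fun x => ?_, ?_⟩
    · rw [hmax]
      exact mul_le_mul_of_nonneg_left (dotProduct_adjMatrix_mulVec_le hreg x) hγ.le
    · have hone : (couplingMatrix G α γ).mulVec (fun _ => 1) = fun _ => α + γ * lamMax G := by
        rw [couplingMatrix_mulVec, adjMatrix_mulVec_one_of_regular hreg, hmax]
        ext i
        simp
      rw [unbiasedField_eq_couplingField]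
      filter_upwards [hS.eventually_mem_consensusSpace (couplingMatrix_isSymm G α γ) hd hpos hone
        fun x hx => hWmax ▸ (couplingMatrix_mulVec_eq_iff hγ.ne').1 hx] with p hp hx
      obtain ⟨u, x⟩ := p
      obtain ⟨c, rfl⟩ : ∃ c, x = fun _ => c := hp hx.2
      obtain ⟨hs, hcons⟩ := isConsensusState_const hx.1
      exact ⟨hs, fun θ hθ i k => by simpa using hθ, hcons⟩
  · rintro hγ _ rfl
    have hpos : 0 < α + γ * lamMin G := by
      have := mul_nonneg_of_nonpos_of_nonpos hγ.le (lamMin_nonpos G)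
      linarith
    have hbif := hS.hasBifurcationAlong_genEigenspace hd hγ.ne hpos
      (lamMax_lamMin_spec G).2.1 fun x =>
        mul_le_mul_of_nonpos_left (lamMin_mul_le_dotProduct G x) hγ.le
    refine ⟨hpos, hbif, fun θ hθ => ?_, fun ε hε => hbif.eventually_isDissensusState hWmin hε⟩
    -- A fixed `θ` is covered by the relative statement with `ε = 1` once `‖x‖ < θ`.
    filter_upwards [hbif.eventually_isDissensusState hWmin one_pos,
      eventually_norm_snd_lt _ hθ] with p hp hlt hx
    exact (hp hx θ (by rw [one_mul]; exact hlt.le)).1
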